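/- Let $d\ge 1$, let $\mathcal X\subset\mathbb R^d$ be a nonempty closed convex set, let $F:\mathcal X\to\mathbb R^d$, let $x_*\in\mathcal X$ be a fixed point of $F$ ($F(x_*)=x_*$), and let $\eta,\varepsilon>0$. For a symmetric positive definite $d\times d$ real matrix $A$ write $\|x\|_A=\sqrt{\langle x,Ax\rangle}$, let $\Pi_{\mathcal X,A}$ be the projection onto $\mathcal X$ with respect to $\|\cdot\|_A$, let $\lambda_{\max}(A)$ be the largest eigenvalue of $A$, and call $F$ $A$-nonexpansive if $I+A^{-1}(F-I)$ is nonexpansive for $\|\cdot\|_A$ on $\mathcal X$, that is, $\|(x'+A^{-1}(F(x')-x'))-(x+A^{-1}(F(x)-x))\|_A\le\|x'-x\|_A$ for all $x,x'\in\mathcal X$. Let $x_1\in\mathcal X$ and, for $t\ge1$, \[ x_{t+1}=\Pi_{\mathcal X,A_t}\bigl(x_t+A_t^{-1}(F(x_t)-x_t)\bigr),\qquad A_t=\eta^{-1}\Bigl(\varepsilon^2 I_d+\sum_{s=1}^t (F(x_s)-x_s)(F(x_s)-x_s)^\top\Bigr)^{1/2}. \] Let $T\ge1$ be an integer, let $A$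 be a symmetric positive definite $d\times d$ real matrix, and let $D_{2,T}=\max_{1\le t\le T}\|x_t-x_*\|_2$. (i) If for all $1\le t\le T$ \[ \|F(x_t)-x_t\|_{A^{-1}}^2\le 2\langle F(x_t)-x_t,\;x_*-x_t\rangle , \] then \[ \min_{1\le t\le T}\|F(x_t)-x_t\|_{A^{-1}}\le\sqrt{\frac{\operatorname{Tr}A}{T}}\Bigl(\frac{D_{2,T}^2}{\eta}+2\eta\Bigr)+\frac{\varepsilon}{\sqrt{T\operatorname{Tr}A}} \] and \[ \min_{1\le t\le T}\|F(x_t)-x_t\|_{2}\le\sqrt{\frac{\lambda_{\max}(A)\operatorname{Tr}A}{T}}\Bigl(\frac{D_{2,T}^2}{\eta}+2\eta\Bigr)+\frac{\varepsilon}{\sqrt{T}} . \] (ii) Under the same condition on $A$, if moreover $D$ is a real number with $D\ge\operatorname{diam}_2(\mathcal X)=\sup_{x,x'\in\mathcal X}\|x'-x\|_2$ and $\eta=D/\sqrt2$, then \[ \min_{1\le t\le T}\|F(x_t)-x_t\|_{A^{-1}}\le 2D\sqrt{\frac{2\operatorname{Tr}A}{T}}+\frac{\varepsilon}{\sqrt{T\operatorname{Tr}A}}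 \quad\text{and}\quad \min_{1\le t\le T}\|F(x_t)-x_t\|_{2}\le 2D\sqrt{\frac{2\lambda_{\max}(A)\operatorname{Tr}A}{T}}+\frac{\varepsilon}{\sqrt{T}} . \] (iii) In particular, if $F$ is $A$-nonexpansive, the inequalities of (i) hold, and so do those of (ii) whenever $D\ge\operatorname{diam}_2(\mathcal X)$ and $\eta=D/\sqrt2$. -/

import Mathlib

open scoped MatrixOrder

namespace AdaGradFull

/-- `ℝ^d` with the canonical inner product and the Euclidean norm. -/
abbrev E (d : ℕ) : Type := EuclideanSpace ℝ (Fin d)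

/-- The Mahalanobis norm `‖x‖_A = √⟨x, A x⟩`. -/
noncomputable def mahalanobisNorm {d : ℕ} (A : Matrix (Fin d) (Fin d) ℝ) (x : E d) : ℝ :=
  Real.sqrt (inner ℝ x (Matrix.toEuclideanLin A x))

/-- `p` is a point of `X` at minimal `‖·‖_A`-distance from `y`. -/
def IsMahalanobisProj {d : ℕ} (X : Set (E d)) (A : Matrix (Fin d) (Fin d) ℝ) (y p : E d) : Prop :=
  p ∈ X ∧ ∀ z ∈ X, mahalanobisNorm A (y - p) ≤ mahalanobisNorm A (y - z)

/-- The projection onto `X` with respect to `‖·‖_A`. -/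
noncomputable def mahalanobisProj {d : ℕ} (X : Set (E d)) (A : Matrix (Fin d) (Fin d) ℝ)
    (y : E d) : E d :=
  Classical.epsilon (IsMahalanobisProj X A y)

/-- The square root of a positive definite matrix turns `‖·‖_A` into the Euclidean norm. -/
theorem exists_equiv_mahalanobisNorm {d : ℕ} {A : Matrix (Fin d) (Fin d) ℝ} (hA : A.PosDef) :
    ∃ L : E d ≃L[ℝ] E d, ∀ x, mahalanobisNorm A x = ‖L x‖ := by
  obtain ⟨B, hB, hAB⟩ : ∃ B : Matrix (Fin d) (Fin d) ℝ, IsUnit B ∧ A = B.transpose * B := by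
    have h0 : (0 : Matrix (Fin d) (Fin d) ℝ) ≤ A := Matrix.nonneg_iff_posSemidef.2 hA.posSemidef
    have hs : CFC.sqrt A * CFC.sqrt A = A := CFC.sqrt_mul_sqrt_self A h0
    have hh : (CFC.sqrt A).transpose = CFC.sqrt A := by
      have := (Matrix.nonneg_iff_posSemidef.1 (CFC.sqrt_nonneg A)).isHermitian
      simpa [Matrix.IsHermitian, Matrix.conjTranspose_eq_transpose_of_trivial] using this
    refine ⟨CFC.sqrt A, ?_, by rw [hh, hs]⟩
    have hu : IsUnit (CFC.sqrt A * CFC.sqrt A) := by rw [hs]; exact hA.isUnit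
    exact isUnit_of_mul_isUnit_left hu
  have hinj : Function.Injective (Matrix.toEuclideanLin B) := by
    intro x y hxy
    have h1 : B.mulVec x.ofLp = B.mulVec y.ofLp := congrArg WithLp.ofLp hxy
    exact WithLp.ofLp_injective 2 (Matrix.mulVec_injective_of_isUnit hB h1)
  refine ⟨(LinearEquiv.ofInjectiveEndo _ hinj).toContinuousLinearEquiv, fun x => ?_⟩
  have hn : ‖Matrix.toEuclideanLin B x‖ ^ 2 = inner ℝ x (Matrix.toEuclideanLin A x) := by
    rw [← real_inner_self_eq_norm_sq, hAB]
    simp only [EuclideanSpace.inner_eq_star_dotProduct, Matrix.ofLp_toLpLin, Matrix.toLin'_apply,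
      star_trivial]
    rw [← Matrix.mulVec_mulVec, Matrix.mulVec_transpose, ← Matrix.dotProduct_mulVec]
  rw [mahalanobisNorm, ← hn, Real.sqrt_sq (norm_nonneg _)]
  rfl

/-- On a nonempty closed convex set, the `‖·‖_A`-projection of every point exists and is unique. -/
theorem existsUnique_isMahalanobisProj {d : ℕ} {X : Set (E d)} (hne : X.Nonempty)
    (hcl : IsClosed X) (hcv : Convex ℝ X) {A : Matrix (Fin d) (Fin d) ℝ} (hA : A.PosDef) (y : E d) :
    ∃! p, IsMahalanobisProj X A y p := by
  obtain ⟨L, hL⟩ := exists_equiv_mahalanobisNorm hA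
  have hneL : (L '' X).Nonempty := hne.image L
  have hclL : IsClosed (L '' X) := L.toHomeomorph.isClosedMap X hcl
  have hcvL : Convex ℝ (L '' X) := hcv.linear_image (L : E d →ₗ[ℝ] E d)
  have key : ∀ p ∈ X, IsMahalanobisProj X A y p ↔
      ‖L y - L p‖ = ⨅ w : L '' X, ‖L y - w‖ := by
    intro p hp
    have : Nonempty (L '' X) := hneL.to_subtype
    have hbdd : BddBelow (Set.range fun w : L '' X => ‖L y - w‖) :=
      ⟨0, by rintro _ ⟨w, rfl⟩; exact norm_nonneg _⟩
    constructor
    · intro h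
      refine le_antisymm (le_ciInf ?_) (ciInf_le hbdd ⟨L p, Set.mem_image_of_mem L hp⟩)
      rintro ⟨_, z, hz, rfl⟩
      simpa [hL] using h.2 z hz
    · intro h
      refine ⟨hp, fun z hz => ?_⟩
      rw [hL, hL, map_sub, map_sub, h]
      exact ciInf_le hbdd ⟨L z, Set.mem_image_of_mem L hz⟩
  obtain ⟨_, ⟨p, hp, rfl⟩, hpe⟩ :=
    exists_norm_eq_iInf_of_complete_convex hneL hclL.isComplete hcvL (L y)
  refine ⟨p, (key p hp).2 hpe, fun q hq => ?_⟩
  have hqe := (key q hq.1).1 hq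
  have h1 := (norm_eq_iInf_iff_real_inner_le_zero hcvL (Set.mem_image_of_mem L hp)).1 hpe
    (L q) (Set.mem_image_of_mem L hq.1)
  have h2 := (norm_eq_iInf_iff_real_inner_le_zero hcvL (Set.mem_image_of_mem L hq.1)).1 hqe
    (L p) (Set.mem_image_of_mem L hp)
  have h3 : inner ℝ (L q - L p) (L q - L p) ≤ 0 := by
    have e : inner ℝ (L q - L p) (L q - L p)
        = inner ℝ (L y - L p) (L q - L p) + inner ℝ (L y - L q) (L p - L q) := by
      have : L p - L q = -(L q - L p) := by abel
      rw [this, inner_neg_right, ← sub_eq_add_neg, ← inner_sub_left]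
      congr 1
      abel
    linarith
  have h4 : L q - L p = 0 := real_inner_self_nonpos.1 h3
  exact L.injective (sub_eq_zero.1 h4)

theorem isMahalanobisProj_mahalanobisProj {d : ℕ} {X : Set (E d)} (hne : X.Nonempty)
    (hcl : IsClosed X) (hcv : Convex ℝ X) {A : Matrix (Fin d) (Fin d) ℝ} (hA : A.PosDef) (y : E d) :
    IsMahalanobisProj X A y (mahalanobisProj X A y) :=
  Classical.epsilon_spec (existsUnique_isMahalanobisProj hne hcl hcv hA y).exists

/-- `F : X → ℝ^d` is nonexpansive with respect to the norm `N`. -/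
def IsNonexpansive {d : ℕ} {X : Set (E d)} (N : E d → ℝ) (F : X → E d) : Prop :=
  ∀ x x' : X, N (F x' - F x) ≤ N ((x' : E d) - (x : E d))

/-- `F` is `A`-nonexpansive: `I + A⁻¹ (F - I)` is nonexpansive for `‖·‖_A`. -/
def IsMatrixNonexpansive {d : ℕ} {X : Set (E d)} (A : Matrix (Fin d) (Fin d) ℝ)
    (F : X → E d) : Prop :=
  IsNonexpansive (mahalanobisNorm A)
    (fun x : X => (x : E d) + Matrix.toEuclideanLin A⁻¹ (F x - (x : E d)))

/-- The matrix `A_t = η⁻¹ (ε² I_d + ∑_{s=1}^t u_s u_sᵀ)^{1/2}` with `u_s = F(x_s) - x_s`. -/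
noncomputable def scaling {d : ℕ} {X : Set (E d)} (F : X → E d) (η ε : ℝ) (x : ℕ → X) (t : ℕ) :
    Matrix (Fin d) (Fin d) ℝ :=
  η⁻¹ • CFC.sqrt (ε ^ 2 • (1 : Matrix (Fin d) (Fin d) ℝ) +
    ∑ s ∈ Finset.Icc 1 t,
      Matrix.vecMulVec (F (x s) - (x s : E d)).ofLp (F (x s) - (x s : E d)).ofLp)

/-- `x_1, x_2, …` are AdaGrad-Full iterates for `F` (the entry `x_0` plays no role):
`x_{t+1} = Π_{X, A_t} (x_t + A_t⁻¹ (F(x_t) - x_t))` for `t ≥ 1`. -/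
def IsAdaGradFull {d : ℕ} {X : Set (E d)} (F : X → E d) (η ε : ℝ) (x : ℕ → X) : Prop :=
  ∀ t : ℕ, 1 ≤ t → (x (t + 1) : E d) =
    mahalanobisProj X (scaling F η ε x t)
      ((x t : E d) + Matrix.toEuclideanLin (scaling F η ε x t)⁻¹ (F (x t) - (x t : E d)))

/-- The trajectory condition: `‖F(x_t) - x_t‖²_{A⁻¹} ≤ 2 ⟨F(x_t) - x_t, x_* - x_t⟩`
for all `1 ≤ t ≤ T`. -/
def TrajectoryCondition {d : ℕ} {X : Set (E d)} (F : X → E d) (x : ℕ → X) (xstar : X) (T : ℕ)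
    (A : Matrix (Fin d) (Fin d) ℝ) : Prop :=
  ∀ t : ℕ, 1 ≤ t → t ≤ T →
    mahalanobisNorm A⁻¹ (F (x t) - (x t : E d)) ^ 2 ≤
      2 * inner ℝ (F (x t) - (x t : E d)) ((xstar : E d) - (x t : E d))

/-- The largest eigenvalue of a symmetric matrix. -/
noncomputable def lambdaMax {d : ℕ} (A : Matrix (Fin d) (Fin d) ℝ) : ℝ := sSup (spectrum ℝ A)

/-- `min_{1 ≤ t ≤ T} f t`. -/
noncomputable def minUpTo (T : ℕ) (hT : 1 ≤ T) (f : ℕ → ℝ) : ℝ :=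
  (Finset.Icc 1 T).inf' (Finset.nonempty_Icc.mpr hT) f

/-- `max_{1 ≤ t ≤ T} f t`. -/
noncomputable def maxUpTo (T : ℕ) (hT : 1 ≤ T) (f : ℕ → ℝ) : ℝ :=
  (Finset.Icc 1 T).sup' (Finset.nonempty_Icc.mpr hT) f

end AdaGradFull

/-!
The iteration is mirror descent with a matrix step size, run on the residuals
`u_t = F(x_t) - x_t`. With `S_t = (ε² I + ∑_{s ≤ t} u_s u_sᵀ)^{1/2}`, so that `A_t = η⁻¹ S_t`,
nonexpansiveness of the `A_t`-projection gives, for every point `z` of `X`,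
`2 ⟨u_t, z - x_t⟩ ≤ ‖x_t - z‖²_{A_t} - ‖x_{t+1} - z‖²_{A_t} + ‖u_t‖²_{A_t⁻¹}`.

Summing over `t ≤ T`, two facts turn everything into traces. As `S_t² ≤ S_{t+1}²`, also
`S_t ≤ S_{t+1}` (`sub_posSemidef_of_mul_self_le`), so the change of norm costs at most
`‖x_{t+1} - z‖² Tr (S_{t+1} - S_t) / η`; and
`‖u_{t+1}‖²` in the norm of `S_{t+1}⁻¹` is at most `2 Tr (S_{t+1} - S_t)`
(`quadForm_gramRoot_inv_le`). Starting the telescoping at `S_0 = ε I` rather than at `S_1` keeps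
the dimension out of the `ε` term. With `C = D² / η + 2 η` this is
`∑ 2 ⟨u_t, z - x_t⟩ ≤ (D² / η) ε + C (Tr S_T - Tr S_0)` (`IsAdaGradFull.sum_inner_le`).

Put `r² = ∑ ‖u_t‖²_{A⁻¹}`. The trajectory condition at `z = x_*` bounds `r²` by the left-hand side.
On the right, `S_T ≤ ε I + M^{1/2}` with `M = ∑ u_t u_tᵀ`, and the trace Cauchy–Schwarz inequality
`(Tr M^{1/2})² ≤ Tr A · Tr (A⁻¹ M)` (`sq_trace_le`) gives `Tr S_T - Tr S_0 ≤ √(Tr A) r`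
(`trace_gramRoot_sub_le`). Hence `r² ≤ C ε + C √(Tr A) r`, which forces
`r ≤ C √(Tr A) + ε / √(Tr A)` (`IsAdaGradFull.sqrt_sum_quadForm_le`), and the smallest residual is
at most `r / √T`. The Euclidean bound follows from `‖u‖² ≤ λ_max(A) ‖u‖²_{A⁻¹}` and
`λ_max(A) ≤ Tr A`. An `A`-nonexpansive map satisfies the trajectory condition
(`IsMatrixNonexpansive.trajectoryCondition`).
-/

namespace AdaGradFull

/-! ### Traces and order of positive definite matrices -/

section Matrices

variable {n : Type*} [Fintype n] [DecidableEq n]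

/-- The square root is operator monotone, stated for the roots: `S² ≤ R²` implies `S ≤ R`. -/
theorem sub_posSemidef_of_mul_self_le {S R : Matrix n n ℝ} (hS : S.PosSemidef) (hR : R.PosDef)
    (h : (R * R - S * S).PosSemidef) : (R - S).PosSemidef := by
  have hH : (R - S).IsHermitian := hR.isHermitian.sub hS.isHermitian
  rw [hH.posSemidef_iff_eigenvalues_nonneg]
  intro i
  by_contra! hneg
  simp only [Pi.zero_apply] at hneg
  set μ := hH.eigenvalues i
  set v : n → ℝ := (hH.eigenvectorBasis i).ofLp
  have hv : v ≠ 0 := fun h0 => hH.eigenvectorBasis.toBasis.ne_zero i (by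
    simpa using WithLp.ofLp_injective 2 h0)
  have hev : (R - S).mulVec v = μ • v := hH.mulVec_eigenvectorBasis i
  have hve : Matrix.vecMul v (R - S) = μ • v := by
    rw [← hev, ← Matrix.vecMul_transpose]
    congr 1
    simpa [Matrix.IsHermitian, Matrix.conjTranspose_eq_transpose_of_trivial] using hH.symm
  have h1 : 0 ≤ v ⬝ᵥ (R * R - S * S).mulVec v := by simpa using h.dotProduct_mulVec_nonneg v
  have h2 : 0 < v ⬝ᵥ R.mulVec v := by simpa using hR.dotProduct_mulVec_pos hv
  have h3 : 0 ≤ v ⬝ᵥ S.mulVec v := by simpa using hS.dotProduct_mulVec_nonneg v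
  -- `2 (R² - S²) = (R - S)(R + S) + (R + S)(R - S)`, and `v` is an eigenvector of `R - S`.
  have e : (R * R - S * S) = (2⁻¹ : ℝ) • ((R - S) * (R + S) + (R + S) * (R - S)) := by
    rw [show (R - S) * (R + S) + (R + S) * (R - S) = (2 : ℝ) • (R * R - S * S) by
      rw [two_smul]; noncomm_ring]
    simp
  have h4 : v ⬝ᵥ (R * R - S * S).mulVec v = μ * (v ⬝ᵥ R.mulVec v + v ⬝ᵥ S.mulVec v) := by
    rw [e, Matrix.smul_mulVec, Matrix.add_mulVec, ← Matrix.mulVec_mulVec, ← Matrix.mulVec_mulVec,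
      hev, dotProduct_smul, dotProduct_add, Matrix.dotProduct_mulVec v (R - S), hve,
      Matrix.mulVec_smul, Matrix.add_mulVec, smul_dotProduct, dotProduct_smul, dotProduct_add]
    simp only [smul_eq_mul]
    ring
  nlinarith

/-- `Tr (A⁻¹ (K - c A)²)` is nonnegative. -/
theorem trace_inv_mul_sq_sub_nonneg {A K : Matrix n n ℝ} (hA : A.PosDef) (hK : K.IsHermitian)
    (c : ℝ) : 0 ≤ (A⁻¹ * (K * K)).trace - 2 * c * K.trace + c ^ 2 * A.trace := by
  have hdet : IsUnit A.det := (Matrix.isUnit_iff_isUnit_det A).1 hA.isUnit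
  have hH : (K - c • A).IsHermitian :=
    hK.sub (by rw [Matrix.IsHermitian, Matrix.conjTranspose_smul, hA.isHermitian.eq]; simp)
  have h := (hA.inv.posSemidef.conjTranspose_mul_mul_same (K - c • A)).trace_nonneg
  rw [hH.eq, Matrix.trace_mul_comm, ← mul_assoc, Matrix.trace_mul_comm] at h
  have e : A⁻¹ * ((K - c • A) * (K - c • A)) =
      A⁻¹ * (K * K) - c • (A⁻¹ * (K * A)) - c • K + c ^ 2 • A := by
    simp only [sub_mul, mul_sub, smul_mul_assoc, mul_smul_comm,
      Matrix.nonsing_inv_mul_cancel_left A _ hdet, pow_two, mul_smul, smul_sub]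
    abel
  have e2 : (A⁻¹ * (K * A)).trace = K.trace := by
    rw [Matrix.trace_mul_comm, mul_assoc, Matrix.mul_nonsing_inv A hdet, mul_one]
  rw [e] at h
  simp only [Matrix.trace_add, Matrix.trace_sub, Matrix.trace_smul, smul_eq_mul, e2] at h
  linarith

/-- Cauchy–Schwarz for `Tr K = Tr (A^{1/2} (A^{-1/2} K))`, read off as a discriminant. -/
theorem sq_trace_le {A K : Matrix n n ℝ} (hA : A.PosDef) (hK : K.IsHermitian) :
    K.trace ^ 2 ≤ A.trace * (A⁻¹ * (K * K)).trace := by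
  have key : ∀ c : ℝ, 0 ≤ A.trace * (c * c) + (-2 * K.trace) * c + (A⁻¹ * (K * K)).trace :=
    fun c => by linarith [trace_inv_mul_sq_sub_nonneg hA hK c]
  have := discrim_le_zero key
  rw [discrim] at this
  linarith

theorem smul_one_sub_posSemidef {A : Matrix n n ℝ} (hA : A.IsHermitian) {c : ℝ}
    (hc : ∀ i, hA.eigenvalues i ≤ c) : (c • (1 : Matrix n n ℝ) - A).PosSemidef := by
  rw [Matrix.posSemidef_iff_isHermitian_and_spectrum_nonneg]
  refine ⟨Matrix.IsHermitian.sub (by simp [Matrix.IsHermitian]) hA, ?_⟩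
  rw [← Algebra.algebraMap_eq_smul_one, ← spectrum.singleton_sub_eq,
    hA.spectrum_real_eq_range_eigenvalues]
  rintro _ ⟨_, rfl, _, ⟨i, rfl⟩, rfl⟩
  simpa using hc i

theorem eigenvalues_le_trace {A : Matrix n n ℝ} (hA : A.PosSemidef) (i : n) :
    hA.isHermitian.eigenvalues i ≤ A.trace := by
  rw [hA.isHermitian.trace_eq_sum_eigenvalues]
  exact Finset.single_le_sum (f := fun i => hA.isHermitian.eigenvalues i)
    (fun j _ => hA.eigenvalues_nonneg j) (Finset.mem_univ i)

end Matrices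

/-! ### Quadratic forms and projections in the norm of a matrix -/

section QuadraticForm

variable {d : ℕ}

/-- The quadratic form `⟨x, A x⟩`. -/
noncomputable def quadForm (A : Matrix (Fin d) (Fin d) ℝ) (x : E d) : ℝ :=
  inner ℝ x (Matrix.toEuclideanLin A x)

theorem quadForm_eq_dotProduct (A : Matrix (Fin d) (Fin d) ℝ) (x : E d) :
    quadForm A x = x.ofLp ⬝ᵥ A.mulVec x.ofLp := by
  rw [quadForm, EuclideanSpace.inner_eq_star_dotProduct, dotProduct_comm]
  simp [Matrix.ofLp_toLpLin]

theorem quadForm_nonneg {A : Matrix (Fin d) (Fin d) ℝ} (hA : A.PosSemidef) (x : E d) :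
    0 ≤ quadForm A x := by
  rw [quadForm_eq_dotProduct]
  simpa using hA.dotProduct_mulVec_nonneg x.ofLp

theorem mahalanobisNorm_nonneg (A : Matrix (Fin d) (Fin d) ℝ) (x : E d) :
    0 ≤ mahalanobisNorm A x :=
  Real.sqrt_nonneg _

theorem mahalanobisNorm_sq {A : Matrix (Fin d) (Fin d) ℝ} (hA : A.PosSemidef) (x : E d) :
    mahalanobisNorm A x ^ 2 = quadForm A x :=
  Real.sq_sqrt (quadForm_nonneg hA x)

theorem quadForm_sub_matrix (A B : Matrix (Fin d) (Fin d) ℝ) (x : E d) :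
    quadForm (A - B) x = quadForm A x - quadForm B x := by
  simp [quadForm, inner_sub_right]

theorem quadForm_smul_matrix (c : ℝ) (A : Matrix (Fin d) (Fin d) ℝ) (x : E d) :
    quadForm (c • A) x = c * quadForm A x := by
  simp [quadForm, inner_smul_right]

theorem quadForm_one (x : E d) : quadForm 1 x = ‖x‖ ^ 2 := by
  simp [quadForm]

theorem toEuclideanLin_apply_inv {A : Matrix (Fin d) (Fin d) ℝ} (hA : A.PosDef) (u : E d) :
    Matrix.toEuclideanLin A (Matrix.toEuclideanLin A⁻¹ u) = u := by
  have hdet : IsUnit A.det := (Matrix.isUnit_iff_isUnit_det A).1 hA.isUnit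
  apply WithLp.ofLp_injective 2
  simp [Matrix.ofLp_toLpLin, Matrix.mulVec_mulVec, Matrix.mul_nonsing_inv A hdet]

theorem inner_toEuclideanLin_comm {A : Matrix (Fin d) (Fin d) ℝ} (hA : A.IsHermitian)
    (x y : E d) :
    inner ℝ (Matrix.toEuclideanLin A x) y = inner ℝ x (Matrix.toEuclideanLin A y) :=
  (Matrix.isSymmetric_toEuclideanLin_iff.2 hA) x y

/-- Completing the square. -/
theorem quadForm_add_inv {A : Matrix (Fin d) (Fin d) ℝ} (hA : A.PosDef) (v u : E d) :
    quadForm A (v + Matrix.toEuclideanLin A⁻¹ u) =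
      quadForm A v + 2 * inner ℝ u v + quadForm A⁻¹ u := by
  simp only [quadForm, map_add, inner_add_left, inner_add_right, toEuclideanLin_apply_inv hA]
  rw [← inner_toEuclideanLin_comm hA.isHermitian (Matrix.toEuclideanLin A⁻¹ u) v,
    toEuclideanLin_apply_inv hA, real_inner_comm u v,
    real_inner_comm u (Matrix.toEuclideanLin A⁻¹ u)]
  ring

theorem quadForm_le_of_eigenvalues_le {A : Matrix (Fin d) (Fin d) ℝ} (hA : A.IsHermitian) {c : ℝ}
    (hc : ∀ i, hA.eigenvalues i ≤ c) (x : E d) : quadForm A x ≤ c * ‖x‖ ^ 2 := by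
  have h := quadForm_nonneg (smul_one_sub_posSemidef hA hc) x
  rw [quadForm_sub_matrix, quadForm_smul_matrix, quadForm_one] at h
  linarith

theorem quadForm_le_trace {A : Matrix (Fin d) (Fin d) ℝ} (hA : A.PosSemidef) (x : E d) :
    quadForm A x ≤ A.trace * ‖x‖ ^ 2 :=
  quadForm_le_of_eigenvalues_le hA.isHermitian (eigenvalues_le_trace hA) x

theorem trace_mul_vecMulVec_self (A : Matrix (Fin d) (Fin d) ℝ) (u : E d) :
    (A * Matrix.vecMulVec u.ofLp u.ofLp).trace = quadForm A u := by
  rw [Matrix.mul_vecMulVec, Matrix.trace_vecMulVec, quadForm_eq_dotProduct, dotProduct_comm]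

theorem eigenvalues_le_lambdaMax {A : Matrix (Fin d) (Fin d) ℝ} (hA : A.IsHermitian) (i : Fin d) :
    hA.eigenvalues i ≤ lambdaMax A := by
  refine le_csSup ?_ ?_ <;> rw [hA.spectrum_real_eq_range_eigenvalues]
  · exact (Set.finite_range _).bddAbove
  · exact Set.mem_range_self i

theorem lambdaMax_le_trace {A : Matrix (Fin d) (Fin d) ℝ} (hA : A.PosSemidef) :
    lambdaMax A ≤ A.trace := by
  refine Real.sSup_le ?_ hA.trace_nonneg
  rw [hA.isHermitian.spectrum_real_eq_range_eigenvalues]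
  rintro _ ⟨i, rfl⟩
  exact eigenvalues_le_trace hA i

theorem lambdaMax_nonneg {A : Matrix (Fin d) (Fin d) ℝ} (hA : A.PosSemidef) :
    0 ≤ lambdaMax A := by
  refine Real.sSup_nonneg ?_
  rw [hA.isHermitian.spectrum_real_eq_range_eigenvalues]
  rintro _ ⟨i, rfl⟩
  exact hA.eigenvalues_nonneg i

theorem norm_sq_le_lambdaMax_mul {A : Matrix (Fin d) (Fin d) ℝ} (hA : A.PosDef) (u : E d) :
    ‖u‖ ^ 2 ≤ lambdaMax A * quadForm A⁻¹ u := by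
  -- Evaluate the nonnegative form of `A` at `A⁻¹ u - s u` and optimise over `s`.
  have key : ∀ s : ℝ, 0 ≤ quadForm A u * (s * s) + (2 * ‖u‖ ^ 2) * s + quadForm A⁻¹ u := by
    intro s
    have h := quadForm_nonneg hA.posSemidef (s • u + Matrix.toEuclideanLin A⁻¹ u)
    rw [quadForm_add_inv hA, inner_smul_right, real_inner_self_eq_norm_sq] at h
    simp only [quadForm, map_smul, inner_smul_left, inner_smul_right] at h ⊢
    simp only [conj_trivial] at h
    linarith
  have h1 := discrim_le_zero key
  rw [discrim] at h1
  have h2 := quadForm_le_of_eigenvalues_le hA.isHermitian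
    (eigenvalues_le_lambdaMax hA.isHermitian) u
  have h3 := quadForm_nonneg hA.inv.posSemidef u
  rcases (sq_nonneg ‖u‖).eq_or_lt with h0 | h0
  · rw [← h0]; exact mul_nonneg (lambdaMax_nonneg hA.posSemidef) h3
  · have h4 := mul_le_mul_of_nonneg_right h2 h3
    refine le_of_mul_le_mul_left ?_ h0
    nlinarith

/-- A `‖·‖_A`-projection does not increase the `‖·‖_A`-distance to the points of `X`. -/
theorem IsMahalanobisProj.quadForm_le {X : Set (E d)} (hcv : Convex ℝ X)
    {A : Matrix (Fin d) (Fin d) ℝ} (hA : A.PosDef) {y p : E d} (hp : IsMahalanobisProj X A y p)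
    {z : E d} (hz : z ∈ X) : quadForm A (p - z) ≤ quadForm A (y - z) := by
  obtain ⟨L, hL⟩ := exists_equiv_mahalanobisNorm hA
  have hcvL : Convex ℝ (L '' X) := hcv.linear_image (L : E d →ₗ[ℝ] E d)
  have hinf : ‖L y - L p‖ = ⨅ w : L '' X, ‖L y - w‖ := by
    have : Nonempty (L '' X) := ⟨⟨L p, Set.mem_image_of_mem L hp.1⟩⟩
    refine le_antisymm (le_ciInf ?_) (ciInf_le ⟨0, ?_⟩
      (⟨L p, Set.mem_image_of_mem L hp.1⟩ : L '' X))
    · rintro ⟨_, z, hz, rfl⟩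
      simpa [hL] using hp.2 z hz
    · rintro _ ⟨w, rfl⟩
      exact norm_nonneg _
  have h1 := (norm_eq_iInf_iff_real_inner_le_zero hcvL (Set.mem_image_of_mem L hp.1)).1 hinf
    (L z) (Set.mem_image_of_mem L hz)
  rw [← mahalanobisNorm_sq hA.posSemidef, ← mahalanobisNorm_sq hA.posSemidef, hL, hL,
    map_sub, map_sub]
  have h2 : L y - L z = (L y - L p) - (L z - L p) := by abel
  rw [h2, norm_sub_sq_real (L y - L p), norm_sub_rev (L p)]
  nlinarith [sq_nonneg ‖L y - L p‖]

end QuadraticForm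

/-! ### The preconditioner -/

section Preconditioner

variable {d : ℕ}

/-- The matrix `∑_{s=1}^t u_s u_sᵀ`. -/
noncomputable def gram (u : ℕ → E d) (t : ℕ) : Matrix (Fin d) (Fin d) ℝ :=
  ∑ s ∈ Finset.Icc 1 t, Matrix.vecMulVec (u s).ofLp (u s).ofLp

/-- The regularised square root `(ε² I + ∑_{s=1}^t u_s u_sᵀ)^{1/2}`. -/
noncomputable def gramRoot (ε : ℝ) (u : ℕ → E d) (t : ℕ) : Matrix (Fin d) (Fin d) ℝ :=
  CFC.sqrt (ε ^ 2 • (1 : Matrix (Fin d) (Fin d) ℝ) + gram u t)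

theorem gram_succ (u : ℕ → E d) (t : ℕ) :
    gram u (t + 1) = gram u t + Matrix.vecMulVec (u (t + 1)).ofLp (u (t + 1)).ofLp := by
  rw [gram, Finset.sum_Icc_succ_top (by omega), gram]

theorem gram_posSemidef (u : ℕ → E d) (t : ℕ) : (gram u t).PosSemidef :=
  Matrix.posSemidef_sum _ fun s _ => by
    simpa using Matrix.posSemidef_vecMulVec_self_star (u s).ofLp

theorem trace_mul_gram (A : Matrix (Fin d) (Fin d) ℝ) (u : ℕ → E d) (t : ℕ) :
    (A * gram u t).trace = ∑ s ∈ Finset.Icc 1 t, quadForm A (u s) := by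
  simp only [gram, Finset.mul_sum, Matrix.trace_sum, trace_mul_vecMulVec_self]

theorem regularized_gram_posDef {ε : ℝ} (hε : 0 < ε) (u : ℕ → E d) (t : ℕ) :
    (ε ^ 2 • (1 : Matrix (Fin d) (Fin d) ℝ) + gram u t).PosDef :=
  (Matrix.PosDef.one.smul (by positivity)).add_posSemidef (gram_posSemidef u t)

theorem gramRoot_mul_self {ε : ℝ} (hε : 0 < ε) (u : ℕ → E d) (t : ℕ) :
    gramRoot ε u t * gramRoot ε u t = ε ^ 2 • (1 : Matrix (Fin d) (Fin d) ℝ) + gram u t :=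
  CFC.sqrt_mul_sqrt_self _
    (Matrix.nonneg_iff_posSemidef.2 (regularized_gram_posDef hε u t).posSemidef)

theorem gramRoot_posDef {ε : ℝ} (hε : 0 < ε) (u : ℕ → E d) (t : ℕ) :
    (gramRoot ε u t).PosDef := by
  have hu : IsUnit (gramRoot ε u t * gramRoot ε u t) := by
    rw [gramRoot_mul_self hε]
    exact (regularized_gram_posDef hε u t).isUnit
  exact (Matrix.nonneg_iff_posSemidef.1 (CFC.sqrt_nonneg _)).posDef_iff_isUnit.2
    (isUnit_of_mul_isUnit_left hu)

theorem gramRoot_zero {ε : ℝ} (hε : 0 < ε) (u : ℕ → E d) :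
    gramRoot ε u 0 = ε • (1 : Matrix (Fin d) (Fin d) ℝ) := by
  refine CFC.sqrt_unique ?_ ?_
  · simp [gram, pow_two, mul_smul]
  · exact Matrix.nonneg_iff_posSemidef.2 (Matrix.PosDef.one.smul hε).posSemidef

theorem gramRoot_succ_sub_posSemidef {ε : ℝ} (hε : 0 < ε) (u : ℕ → E d) (t : ℕ) :
    (gramRoot ε u (t + 1) - gramRoot ε u t).PosSemidef := by
  refine sub_posSemidef_of_mul_self_le (gramRoot_posDef hε u t).posSemidef
    (gramRoot_posDef hε u (t + 1)) ?_
  rw [gramRoot_mul_self hε, gramRoot_mul_self hε, gram_succ, ← add_assoc, add_sub_cancel_left]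
  simpa using Matrix.posSemidef_vecMulVec_self_star (u (t + 1)).ofLp

/-- The matrix form of `(b² - a²) / b ≤ 2 (b - a)`: it makes the step sizes sum up to a trace. -/
theorem quadForm_gramRoot_inv_le {ε : ℝ} (hε : 0 < ε) (u : ℕ → E d) (t : ℕ) :
    quadForm (gramRoot ε u (t + 1))⁻¹ (u (t + 1)) ≤
      2 * ((gramRoot ε u (t + 1)).trace - (gramRoot ε u t).trace) := by
  have hR := gramRoot_posDef hε u (t + 1)
  have hdet := (Matrix.isUnit_iff_isUnit_det _).1 hR.isUnit
  have h := trace_inv_mul_sq_sub_nonneg hR (gramRoot_posDef hε u t).isHermitian 1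
  have e : Matrix.vecMulVec (u (t + 1)).ofLp (u (t + 1)).ofLp =
      gramRoot ε u (t + 1) * gramRoot ε u (t + 1) - gramRoot ε u t * gramRoot ε u t := by
    rw [gramRoot_mul_self hε, gramRoot_mul_self hε, gram_succ]
    abel
  rw [← trace_mul_vecMulVec_self, e, mul_sub, Matrix.nonsing_inv_mul_cancel_left _ _ hdet,
    Matrix.trace_sub]
  linarith

/-- The growth of the trace of the preconditioner is controlled by the residuals in the dual norm
of an arbitrary positive definite `A`. -/
theorem trace_gramRoot_sub_le {ε : ℝ} (hε : 0 < ε) (u : ℕ → E d) (t : ℕ)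
    {A : Matrix (Fin d) (Fin d) ℝ} (hA : A.PosDef) :
    (gramRoot ε u t).trace - (gramRoot ε u 0).trace ≤
      √(A.trace * ∑ s ∈ Finset.Icc 1 t, quadForm A⁻¹ (u s)) := by
  set K := CFC.sqrt (gram u t)
  have hK : K.PosSemidef := Matrix.nonneg_iff_posSemidef.1 (CFC.sqrt_nonneg _)
  have hKK : K * K = gram u t :=
    CFC.sqrt_mul_sqrt_self _ (Matrix.nonneg_iff_posSemidef.2 (gram_posSemidef u t))
  have hεK : (ε • (1 : Matrix (Fin d) (Fin d) ℝ) + K).PosDef :=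
    (Matrix.PosDef.one.smul hε).add_posSemidef hK
  -- `(ε² + K²)^{1/2} ≤ ε + K`, since `ε² + K² ≤ (ε + K)²`.
  have h1 : (ε • (1 : Matrix (Fin d) (Fin d) ℝ) + K - gramRoot ε u t).PosSemidef := by
    refine sub_posSemidef_of_mul_self_le (gramRoot_posDef hε u t).posSemidef hεK ?_
    have e : (ε • (1 : Matrix (Fin d) (Fin d) ℝ) + K) * (ε • 1 + K) -
        gramRoot ε u t * gramRoot ε u t = (2 * ε) • K := by
      rw [gramRoot_mul_self hε, ← hKK]
      simp only [add_mul, mul_add, smul_mul_assoc, mul_smul_comm, one_mul, mul_one, pow_two,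
        mul_smul, two_smul, smul_add]
      abel
    rw [e]
    exact hK.smul (by positivity)
  have h2 := h1.trace_nonneg
  have h3 := sq_trace_le hA hK.isHermitian
  rw [hKK, trace_mul_gram] at h3
  rw [gramRoot_zero hε]
  rw [Matrix.trace_sub, Matrix.trace_add] at h2
  linarith [Real.le_sqrt_of_sq_le h3]

end Preconditioner

/-! ### Convergence of the iterates -/

section Iterates

variable {d : ℕ} {X : Set (E d)} {F : X → E d} {η ε : ℝ} {x : ℕ → X}

theorem scaling_eq_smul_gramRoot (F : X → E d) (η ε : ℝ) (x : ℕ → X) (t : ℕ) :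
    scaling F η ε x t = η⁻¹ • gramRoot ε (fun s => F (x s) - (x s : E d)) t := rfl

theorem scaling_posDef (F : X → E d) (x : ℕ → X) (hη : 0 < η) (hε : 0 < ε) (t : ℕ) :
    (scaling F η ε x t).PosDef := by
  rw [scaling_eq_smul_gramRoot]
  exact (gramRoot_posDef hε _ t).smul (by positivity)

theorem quadForm_scaling_inv (hη : 0 < η) (hε : 0 < ε) (t : ℕ) (v : E d) :
    quadForm (scaling F η ε x t)⁻¹ v =
      η * quadForm (gramRoot ε (fun s => F (x s) - (x s : E d)) t)⁻¹ v := by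
  have hdet := (Matrix.isUnit_iff_isUnit_det _).1
    (gramRoot_posDef hε (fun s => F (x s) - (x s : E d)) t).isUnit
  have := Matrix.inv_smul' (gramRoot ε (fun s => F (x s) - (x s : E d)) t)
    (Units.mk0 η⁻¹ (inv_ne_zero hη.ne')) hdet
  rw [scaling_eq_smul_gramRoot, ← quadForm_smul_matrix]
  congr 1
  simpa [Units.smul_def] using this

/-- One step of the mirror-descent argument in the norm of the current preconditioner. -/
theorem IsAdaGradFull.quadForm_step (hcv : Convex ℝ X) (hcl : IsClosed X)
    (hx : IsAdaGradFull F η ε x) (hη : 0 < η) (hε : 0 < ε) (z : X) {t : ℕ} (ht : 1 ≤ t) :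
    2 * inner ℝ (F (x t) - (x t : E d)) ((z : E d) - x t) +
        quadForm (scaling F η ε x t) ((x (t + 1) : E d) - z) ≤
      quadForm (scaling F η ε x t) ((x t : E d) - z) +
        quadForm (scaling F η ε x t)⁻¹ (F (x t) - (x t : E d)) := by
  have hA := scaling_posDef F x hη hε t
  have h := (isMahalanobisProj_mahalanobisProj ⟨z, z.2⟩ hcl hcv hA
    ((x t : E d) + Matrix.toEuclideanLin (scaling F η ε x t)⁻¹ (F (x t) - (x t : E d)))).quadForm_le
    hcv hA z.2
  rw [← hx t ht, add_sub_right_comm, quadForm_add_inv hA, ← neg_sub (z : E d) (x t),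
    inner_neg_right, neg_sub] at h
  linarith

/-- The starting term is paid in the norm of `ε I`, whose form is `ε ‖·‖²`, and only the growth of
the preconditioner is paid through its trace; the dimension therefore does not multiply `ε`. -/
theorem IsAdaGradFull.sum_inner_le (hcv : Convex ℝ X) (hcl : IsClosed X)
    (hx : IsAdaGradFull F η ε x) (hη : 0 < η) (hε : 0 < ε) (z : X) {D : ℝ} {T : ℕ} (hT : 1 ≤ T)
    (hD : ∀ t, 1 ≤ t → t ≤ T → ‖(x t : E d) - z‖ ≤ D) :
    ∑ t ∈ Finset.Icc 1 T, 2 * inner ℝ (F (x t) - (x t : E d)) ((z : E d) - x t) ≤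
      D ^ 2 / η * ε + (D ^ 2 / η + 2 * η) *
        ((gramRoot ε (fun s => F (x s) - (x s : E d)) T).trace -
          (gramRoot ε (fun s => F (x s) - (x s : E d)) 0).trace) := by
  set u : ℕ → E d := fun s => F (x s) - (x s : E d) with hu
  have hsq : ∀ t, 1 ≤ t → t ≤ T → ‖(x t : E d) - z‖ ^ 2 ≤ D ^ 2 := fun t h1 h2 =>
    pow_le_pow_left₀ (norm_nonneg _) (hD t h1 h2) 2
  have key : ∀ t ≤ T,
      ∑ s ∈ Finset.Icc 1 t, 2 * inner ℝ (F (x s) - (x s : E d)) ((z : E d) - x s) +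
        quadForm (scaling F η ε x t) ((x (t + 1) : E d) - z) ≤
      D ^ 2 / η * ε + (D ^ 2 / η + 2 * η) * ((gramRoot ε u t).trace - (gramRoot ε u 0).trace) := by
    intro t
    induction t with
    | zero =>
      intro _
      rw [scaling_eq_smul_gramRoot, ← hu, gramRoot_zero hε, quadForm_smul_matrix,
        quadForm_smul_matrix, quadForm_one]
      have h := mul_le_mul_of_nonneg_left (hsq 1 le_rfl hT) (show 0 ≤ η⁻¹ * ε by positivity)
      simp only [Finset.Icc_eq_empty_of_lt zero_lt_one, Finset.sum_empty, zero_add, sub_self,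
        mul_zero, add_zero, div_eq_mul_inv]
      linarith
    | succ t ih =>
      intro ht
      rw [Finset.sum_Icc_succ_top (by omega)]
      have h1 := ih (by omega)
      have h2 := hx.quadForm_step hcv hcl hη hε z (t := t + 1) (by omega)
      rw [quadForm_scaling_inv hη hε] at h2
      have h3 := mul_le_mul_of_nonneg_left (quadForm_gramRoot_inv_le hε u t) hη.le
      have hP := gramRoot_succ_sub_posSemidef hε u t
      have h4 := (quadForm_le_trace hP ((x (t + 1) : E d) - z)).trans
        (mul_le_mul_of_nonneg_left (hsq (t + 1) (by omega) ht) hP.trace_nonneg)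
      rw [quadForm_sub_matrix, Matrix.trace_sub] at h4
      have h5 := mul_le_mul_of_nonneg_left h4 (inv_pos.2 hη).le
      simp only [scaling_eq_smul_gramRoot, ← hu, quadForm_smul_matrix] at h1 h2 ⊢
      simp only [div_eq_mul_inv] at h1 ⊢
      linarith
  linarith [key T le_rfl, quadForm_nonneg (scaling_posDef F x hη hε T).posSemidef
    ((x (T + 1) : E d) - z)]

/-- The self-bounding inequality `r² ≤ C ε + C √(Tr A) r`, where `r² = ∑ ‖F(x_t) - x_t‖²_{A⁻¹}`,
solved for `r`. -/
theorem IsAdaGradFull.sqrt_sum_quadForm_le (hd : 1 ≤ d) (hcv : Convex ℝ X) (hcl : IsClosed X)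
    (hx : IsAdaGradFull F η ε x) (hη : 0 < η) (hε : 0 < ε) (z : X) {D : ℝ} {T : ℕ} (hT : 1 ≤ T)
    (hD : ∀ t, 1 ≤ t → t ≤ T → ‖(x t : E d) - z‖ ≤ D)
    {A : Matrix (Fin d) (Fin d) ℝ} (hA : A.PosDef) (hc : TrajectoryCondition F x z T A) :
    √(∑ t ∈ Finset.Icc 1 T, quadForm A⁻¹ (F (x t) - (x t : E d))) ≤
      √A.trace * (D ^ 2 / η + 2 * η) + ε / √A.trace := by
  have : Nonempty (Fin d) := ⟨⟨0, hd⟩⟩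
  have htr : 0 < A.trace := hA.trace_pos
  set R := ∑ t ∈ Finset.Icc 1 T, quadForm A⁻¹ (F (x t) - (x t : E d)) with hR
  have hR0 : 0 ≤ R := Finset.sum_nonneg fun t _ => quadForm_nonneg hA.inv.posSemidef _
  have h1 : R ≤ ∑ t ∈ Finset.Icc 1 T, 2 * inner ℝ (F (x t) - (x t : E d)) ((z : E d) - x t) :=
    Finset.sum_le_sum fun t ht => by
      rw [← mahalanobisNorm_sq hA.inv.posSemidef]
      exact hc t (Finset.mem_Icc.1 ht).1 (Finset.mem_Icc.1 ht).2
  have h2 := hx.sum_inner_le hcv hcl hη hε z hT hD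
  have h3 := trace_gramRoot_sub_le hε (fun s => F (x s) - (x s : E d)) T hA
  rw [← hR, Real.sqrt_mul htr.le] at h3
  have hC : 0 ≤ D ^ 2 / η := by positivity
  have h4 := mul_le_mul_of_nonneg_left h3 (show 0 ≤ D ^ 2 / η + 2 * η by positivity)
  have h5 : D ^ 2 / η * ε ≤ (√A.trace * (D ^ 2 / η + 2 * η)) * (ε / √A.trace) := by
    rw [show (√A.trace * (D ^ 2 / η + 2 * η)) * (ε / √A.trace) = (D ^ 2 / η + 2 * η) * ε by
      field_simp]
    exact mul_le_mul_of_nonneg_right (by linarith) hε.le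
  have hp : 0 ≤ √A.trace * (D ^ 2 / η + 2 * η) := by positivity
  have hq : 0 < ε / √A.trace := by positivity
  have h6 : √R * √R = R := Real.mul_self_sqrt hR0
  by_contra! hlt
  set p := √A.trace * (D ^ 2 / η + 2 * η)
  set q := ε / √A.trace
  nlinarith [mul_pos hq (show 0 < √R - p by linarith), mul_nonneg hp hq.le,
    mul_pos (show 0 < √R by linarith) (show 0 < √R - p - q by linarith)]

theorem minUpTo_le {T : ℕ} (hT : 1 ≤ T) (f : ℕ → ℝ) {t : ℕ} (h1 : 1 ≤ t) (h2 : t ≤ T) :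
    minUpTo T hT f ≤ f t :=
  Finset.inf'_le _ (Finset.mem_Icc.2 ⟨h1, h2⟩)

theorem minUpTo_nonneg {T : ℕ} (hT : 1 ≤ T) {f : ℕ → ℝ} (hf : ∀ t, 0 ≤ f t) :
    0 ≤ minUpTo T hT f :=
  Finset.le_inf' _ _ fun t _ => hf t

theorem minUpTo_le_sqrt_sum {T : ℕ} (hT : 1 ≤ T) {f : ℕ → ℝ} (hf : ∀ t, 0 ≤ f t) :
    minUpTo T hT f ≤ √(∑ t ∈ Finset.Icc 1 T, f t ^ 2) / √T := by
  have hT' : (0 : ℝ) < T := by exact_mod_cast hT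
  rw [le_div_iff₀ (by positivity)]
  refine Real.le_sqrt_of_sq_le ?_
  rw [mul_pow, Real.sq_sqrt hT'.le]
  have h := Finset.card_nsmul_le_sum (Finset.Icc 1 T) (fun t => f t ^ 2) (minUpTo T hT f ^ 2)
    fun t ht => pow_le_pow_left₀ (minUpTo_nonneg hT hf)
      (minUpTo_le hT f (Finset.mem_Icc.1 ht).1 (Finset.mem_Icc.1 ht).2) 2
  simp only [Nat.card_Icc, add_tsub_cancel_right, nsmul_eq_mul] at h
  linarith

theorem IsAdaGradFull.minUpTo_mahalanobisNorm_le (hd : 1 ≤ d) (hcv : Convex ℝ X)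
    (hcl : IsClosed X) (hx : IsAdaGradFull F η ε x) (hη : 0 < η) (hε : 0 < ε) (z : X) {D : ℝ}
    {T : ℕ} (hT : 1 ≤ T) (hD : ∀ t, 1 ≤ t → t ≤ T → ‖(x t : E d) - z‖ ≤ D)
    {A : Matrix (Fin d) (Fin d) ℝ} (hA : A.PosDef) (hc : TrajectoryCondition F x z T A) :
    minUpTo T hT (fun t => mahalanobisNorm A⁻¹ (F (x t) - (x t : E d))) ≤
      √(A.trace / T) * (D ^ 2 / η + 2 * η) + ε / √(T * A.trace) := by
  refine (minUpTo_le_sqrt_sum hT fun t => mahalanobisNorm_nonneg _ _).trans ?_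
  simp only [mahalanobisNorm_sq hA.inv.posSemidef]
  have h := div_le_div_of_nonneg_right
    (hx.sqrt_sum_quadForm_le hd hcv hcl hη hε z hT hD hA hc) (Real.sqrt_nonneg (T : ℝ))
  refine h.trans (le_of_eq ?_)
  rw [Real.sqrt_div hA.posSemidef.trace_nonneg, Real.sqrt_mul (Nat.cast_nonneg T), add_div,
    div_div, mul_comm √A.trace √(T : ℝ)]
  ring

/-- Passing to the Euclidean norm costs a factor `√(λ_max A)`; on the `ε` term it is absorbed by
`λ_max A ≤ Tr A`. -/
theorem IsAdaGradFull.minUpTo_norm_le (hd : 1 ≤ d) (hcv : Convex ℝ X)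
    (hcl : IsClosed X) (hx : IsAdaGradFull F η ε x) (hη : 0 < η) (hε : 0 < ε) (z : X) {D : ℝ}
    {T : ℕ} (hT : 1 ≤ T) (hD : ∀ t, 1 ≤ t → t ≤ T → ‖(x t : E d) - z‖ ≤ D)
    {A : Matrix (Fin d) (Fin d) ℝ} (hA : A.PosDef) (hc : TrajectoryCondition F x z T A) :
    minUpTo T hT (fun t => ‖F (x t) - (x t : E d)‖) ≤
      √(lambdaMax A * A.trace / T) * (D ^ 2 / η + 2 * η) + ε / √T := by
  have : Nonempty (Fin d) := ⟨⟨0, hd⟩⟩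
  have htr : 0 < A.trace := hA.trace_pos
  have hT' : (0 : ℝ) < T := by exact_mod_cast hT
  have hl := lambdaMax_nonneg hA.posSemidef
  have h1 : minUpTo T hT (fun t => ‖F (x t) - (x t : E d)‖) ≤
      √(lambdaMax A) * minUpTo T hT (fun t => mahalanobisNorm A⁻¹ (F (x t) - (x t : E d))) := by
    obtain ⟨t, ht, hte⟩ := Finset.exists_mem_eq_inf' (Finset.nonempty_Icc.mpr hT)
      (fun t => mahalanobisNorm A⁻¹ (F (x t) - (x t : E d)))
    rw [Finset.mem_Icc] at ht
    rw [show minUpTo T hT (fun t => mahalanobisNorm A⁻¹ (F (x t) - (x t : E d))) = _ from hte]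
    refine (minUpTo_le hT _ ht.1 ht.2).trans ?_
    refine le_of_sq_le_sq ?_ (mul_nonneg (Real.sqrt_nonneg _) (Real.sqrt_nonneg _))
    rw [mul_pow, Real.sq_sqrt hl, mahalanobisNorm_sq hA.inv.posSemidef]
    exact norm_sq_le_lambdaMax_mul hA _
  have h2 := mul_le_mul_of_nonneg_left
    (hx.minUpTo_mahalanobisNorm_le hd hcv hcl hη hε z hT hD hA hc) (Real.sqrt_nonneg (lambdaMax A))
  refine h1.trans (h2.trans ?_)
  rw [mul_add, ← mul_assoc, ← Real.sqrt_mul hl, ← mul_div_assoc]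
  gcongr
  rw [Real.sqrt_mul hT'.le, ← mul_div_assoc, div_le_div_iff₀ (by positivity) (by positivity)]
  have h3 := Real.sqrt_le_sqrt (lambdaMax_le_trace hA.posSemidef)
  have h4 := mul_le_mul_of_nonneg_right h3 (show 0 ≤ ε * √(T : ℝ) by positivity)
  linarith

/-- If `I + A⁻¹ (F - I)` is nonexpansive for `‖·‖_A`, comparing `x_t` with a fixed point and
expanding the square gives the trajectory condition. -/
theorem IsMatrixNonexpansive.trajectoryCondition {A : Matrix (Fin d) (Fin d) ℝ} (hA : A.PosDef)
    (hF : IsMatrixNonexpansive A F) (x : ℕ → X) {z : X} (hz : F z = z) (T : ℕ) :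
    TrajectoryCondition F x z T A := by
  intro t _ _
  have h := hF z (x t)
  simp only [hz, sub_self, map_zero, add_zero] at h
  have h2 := pow_le_pow_left₀ (mahalanobisNorm_nonneg _ _) h 2
  rw [mahalanobisNorm_sq hA.posSemidef, mahalanobisNorm_sq hA.posSemidef, add_sub_right_comm,
    quadForm_add_inv hA, ← neg_sub (z : E d) (x t), inner_neg_right] at h2
  rw [mahalanobisNorm_sq hA.inv.posSemidef]
  linarith

end Iterates

end AdaGradFull

theorem mainTheorem3 (d : ℕ) (hd : 1 ≤ d)
    (X : Set (AdaGradFull.E d)) (hXne : X.Nonempty) (hXcl : IsClosed X) (hXcv : Convex ℝ X)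
    (F : X → AdaGradFull.E d) (xstar : X) (hfix : F xstar = (xstar : AdaGradFull.E d))
    (η ε : ℝ) (hη : 0 < η) (hε : 0 < ε)
    (x : ℕ → X) (hx : AdaGradFull.IsAdaGradFull F η ε x)
    (T : ℕ) (hT : 1 ≤ T)
    (A : Matrix (Fin d) (Fin d) ℝ) (hA : A.PosDef)
    (D₂ : ℝ)
    (hD₂ : D₂ = AdaGradFull.maxUpTo T hT
      (fun t => ‖(x t : AdaGradFull.E d) - (xstar : AdaGradFull.E d)‖))
    (resA : ℝ)
    (hresA : resA = AdaGradFull.minUpTo T hT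
      (fun t => AdaGradFull.mahalanobisNorm A⁻¹ (F (x t) - (x t : AdaGradFull.E d))))
    (res₂ : ℝ)
    (hres₂ : res₂ = AdaGradFull.minUpTo T hT
      (fun t => ‖F (x t) - (x t : AdaGradFull.E d)‖)) :
    -- guarantees under the trajectory condition
    (AdaGradFull.TrajectoryCondition F x xstar T A →
      resA ≤ √(A.trace / T) * (D₂ ^ 2 / η + 2 * η) + ε / √(T * A.trace) ∧
      res₂ ≤ √(AdaGradFull.lambdaMax A * A.trace / T) * (D₂ ^ 2 / η + 2 * η) + ε / √T ∧
      ∀ D : ℝ, Metric.ediam X ≤ ENNReal.ofReal D → η = D / √2 →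
        resA ≤ 2 * D * √(2 * A.trace / T) + ε / √(T * A.trace) ∧
        res₂ ≤ 2 * D * √(2 * AdaGradFull.lambdaMax A * A.trace / T) + ε / √T) ∧
    -- the same guarantees when `F` is `A`-nonexpansive
    (AdaGradFull.IsMatrixNonexpansive A F →
      resA ≤ √(A.trace / T) * (D₂ ^ 2 / η + 2 * η) + ε / √(T * A.trace) ∧
      res₂ ≤ √(AdaGradFull.lambdaMax A * A.trace / T) * (D₂ ^ 2 / η + 2 * η) + ε / √T ∧
      ∀ D : ℝ, Metric.ediam X ≤ ENNReal.ofReal D → η = D / √2 →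
        resA ≤ 2 * D * √(2 * A.trace / T) + ε / √(T * A.trace) ∧
        res₂ ≤ 2 * D * √(2 * AdaGradFull.lambdaMax A * A.trace / T) + ε / √T) := by
  have hD : ∀ t, 1 ≤ t → t ≤ T → ‖(x t : AdaGradFull.E d) - xstar‖ ≤ D₂ := fun t h1 h2 => by
    rw [hD₂]
    exact Finset.le_sup' (fun t => ‖(x t : AdaGradFull.E d) - xstar‖) (Finset.mem_Icc.2 ⟨h1, h2⟩)
  have main : AdaGradFull.TrajectoryCondition F x xstar T A →
      resA ≤ √(A.trace / T) * (D₂ ^ 2 / η + 2 * η) + ε / √(T * A.trace) ∧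
      res₂ ≤ √(AdaGradFull.lambdaMax A * A.trace / T) * (D₂ ^ 2 / η + 2 * η) + ε / √T ∧
      ∀ D : ℝ, Metric.ediam X ≤ ENNReal.ofReal D → η = D / √2 →
        resA ≤ 2 * D * √(2 * A.trace / T) + ε / √(T * A.trace) ∧
        res₂ ≤ 2 * D * √(2 * AdaGradFull.lambdaMax A * A.trace / T) + ε / √T := by
    intro hc
    have hA' := fun {D' : ℝ} hD' =>
      hx.minUpTo_mahalanobisNorm_le (D := D') hd hXcv hXcl hη hε xstar hT hD' hA hc
    have h2' := fun {D' : ℝ} hD' =>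
      hx.minUpTo_norm_le (D := D') hd hXcv hXcl hη hε xstar hT hD' hA hc
    rw [hresA, hres₂]
    refine ⟨hA' hD, h2' hD, fun D hdiam hηD => ?_⟩
    have hs : (0 : ℝ) < √2 := by positivity
    have hDη : D = √2 * η := by rw [hηD]; field_simp
    have hDpos : 0 < D := by rw [hDη]; positivity
    have hDX : ∀ t, 1 ≤ t → t ≤ T → ‖(x t : AdaGradFull.E d) - xstar‖ ≤ D := fun t _ _ => by
      have h := (Metric.edist_le_ediam_of_mem (x t).2 xstar.2).trans hdiam
      rw [edist_dist, ENNReal.ofReal_le_ofReal_iff hDpos.le, dist_eq_norm] at h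
      exact h
    -- For `η = D / √2` both terms of `D² / η + 2 η` equal `√2 D`.
    have hC : D ^ 2 / η + 2 * η = 2 * D * √2 := by
      have h2 : √2 * √2 = (2 : ℝ) := Real.mul_self_sqrt (by norm_num)
      rw [hDη]
      field_simp
      nlinarith
    have e : ∀ a : ℝ, √a * (2 * D * √2) = 2 * D * √(2 * a) := fun a => by
      rw [Real.sqrt_mul (by norm_num)]
      ring
    have h1 := hA' hDX
    have h2 := h2' hDX
    rw [hC, e, ← mul_div_assoc] at h1 h2
    exact ⟨h1, by rwa [← mul_assoc] at h2⟩
  exact ⟨main, fun hF => main (hF.trajectoryCondition hA x hfix T)⟩
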